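/- Let $SO(3)$ be the group of real $3\times 3$ matrices $R$ with $R^TR=RR^T=\mathbb I_3$ and $\det R=1$, with its usual topology as a subspace of the $3\times3$ matrices. For real numbers $\lambda_1\ge\lambda_2\ge\lambda_3>0$ put $D=\operatorname{diag}(\lambda_1,\lambda_2,\lambda_3)$ and consider the reduced free energy $$W_{1,0}(\,\cdot\,;D):SO(3)\to\mathbb R,\qquad W_{1,0}(R;D)=\bigl\|\operatorname{sym}(R^TD-\mathbb I_3)\bigr\|^2,$$ where $\operatorname{sym}(X)=\tfrac12(X+X^T)$ and $\|X\|^2=\operatorname{tr}(X^TX)$. (i) For all $\lambda_1\ge\lambda_2\ge\lambda_3>0$ (coincidences allowed), every local minimum of $W_{1,0}(\,\cdot\,;D)$ on $SO(3)$ is a global minimum. (ii) On the other hand, there are $\lambda_1\ge\lambda_2\ge\lambda_3>0$ for which $W_{1,0}(\,\cdot\,;D)$ has a local maximum on $SO(3)$ that is not a global maximum. More precisely, if $\lambda_1>\lambda_2>\lambda_3>0$, then $R$ is a local maximum and not a global maximum of $W_{1,0}(\,\cdot\,;D)$ in each of the following cases: $R=\mathbb I_3$ and $\lambda_2+\lambda_3>2$;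 $R=\operatorname{diag}(1,-1,-1)$ and $\lambda_1-\lambda_2>2$; $R=\operatorname{diag}(-1,1,-1)$ and $\lambda_2-\lambda_3>2$. -/

import Mathlib

/-!
On `SO(3)` one has `tr (B²) = (tr B)² - 2 tr (adj B)` and `adj R = Rᵀ`, so `W_{1,0}(· ; F)` is the
restriction to `SO(3)` of a convex quadratic function on all matrices. If `F` is diagonal, that
function depends on the diagonal of `R` only.

In terms of a unit quaternion `q` of `R`, the diagonal of `R` is linear in the squares `q i ^ 2`:
it runs through a tetrahedron whose vertices are the diagonal rotations, with barycentric
coordinates `q i ^ 2`. A segment in the simplex of these squares lifts to the unit sphere by taking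
square roots, hence every segment starting at the diagonal of `R` lifts to a path in `SO(3)`
starting at `R`. Restricted to such a path the energy is convex, so a local minimum is global.

For the maxima, multiplication by a diagonal rotation moves that rotation to the identity at the
cost of changing the signs of two entries of `D`. At the identity the energy, in barycentric
coordinates, decreases along each of the three edges of the tetrahedron that start there.
-/

namespace Cosserat

open Matrix

/-- Symmetric part `(X + Xᵀ) / 2` of a real square matrix. -/
noncomputable def symPart {n : ℕ} (X : Matrix (Fin n) (Fin n) ℝ) : Matrix (Fin n) (Fin n) ℝ :=
  (1 / 2 : ℝ) • (X + Xᵀ)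

/-- Skew-symmetric part `(X - Xᵀ) / 2` of a real square matrix. -/
noncomputable def skewPart {n : ℕ} (X : Matrix (Fin n) (Fin n) ℝ) : Matrix (Fin n) (Fin n) ℝ :=
  (1 / 2 : ℝ) • (X - Xᵀ)

/-- Squared Frobenius norm `‖X‖² = tr (Xᵀ X)`. -/
def frobSq {n : ℕ} (X : Matrix (Fin n) (Fin n) ℝ) : ℝ :=
  (Xᵀ * X).trace

/-- The free energy
`W_{μ,μc}(R; F) = μ ‖sym (Rᵀ F - 1)‖² + μc ‖skew (Rᵀ F - 1)‖²` on `SO(n)`. -/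
noncomputable def freeEnergy {n : ℕ} (μ μc : ℝ) (F : Matrix (Fin n) (Fin n) ℝ)
    (R : specialOrthogonalGroup (Fin n) ℝ) : ℝ :=
  μ * frobSq (symPart ((R : Matrix (Fin n) (Fin n) ℝ)ᵀ * F - 1)) +
    μc * frobSq (skewPart ((R : Matrix (Fin n) (Fin n) ℝ)ᵀ * F - 1))

/-- The reduced free energy `W_{1,0}(· ; D)` on `SO(3)`, where `D = diag(l₁, l₂, l₃)`. -/
noncomputable def reducedEnergy (l₁ l₂ l₃ : ℝ) (R : specialOrthogonalGroup (Fin 3) ℝ) : ℝ :=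
  freeEnergy 1 0 (diagonal ![l₁, l₂, l₃]) R

/-- `x` is a local maximum of `f` (for the topology of the domain) and not a global maximum. -/
def IsNonglobalLocalMax {X : Type*} [TopologicalSpace X] (f : X → ℝ) (x : X) : Prop :=
  IsLocalMax f x ∧ ¬ ∀ y, f y ≤ f x

end Cosserat

namespace Cosserat

open Matrix Set Filter Topology

section SpecialOrthogonalGroup

variable {n K : Type*} [Fintype n] [DecidableEq n] [CommRing K] {A : Matrix n n K}

lemma mem_specialOrthogonalGroup_of_mul_transpose (hA : A * Aᵀ = 1) (hdet : A.det = 1) :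
    A ∈ specialOrthogonalGroup n K :=
  mem_specialOrthogonalGroup_iff.2 ⟨(mem_orthogonalGroup_iff n K).2 hA, hdet⟩

lemma mul_transpose_of_mem_specialOrthogonalGroup (hA : A ∈ specialOrthogonalGroup n K) :
    A * Aᵀ = 1 :=
  (mem_orthogonalGroup_iff n K).1 (mem_specialOrthogonalGroup_iff.1 hA).1

lemma transpose_mul_of_mem_specialOrthogonalGroup (hA : A ∈ specialOrthogonalGroup n K) :
    Aᵀ * A = 1 :=
  (mem_orthogonalGroup_iff' n K).1 (mem_specialOrthogonalGroup_iff.1 hA).1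

lemma adjugate_of_mem_specialOrthogonalGroup (hA : A ∈ specialOrthogonalGroup n K) :
    A.adjugate = Aᵀ := by
  calc A.adjugate = (Aᵀ * A) * A.adjugate := by
        rw [transpose_mul_of_mem_specialOrthogonalGroup hA, one_mul]
    _ = Aᵀ := by
        rw [Matrix.mul_assoc, mul_adjugate, (mem_specialOrthogonalGroup_iff.1 hA).2, one_smul,
          mul_one]

lemma diagonal_mem_specialOrthogonalGroup_iff {e : n → K} :
    diagonal e ∈ specialOrthogonalGroup n K ↔ (∀ i, e i ^ 2 = 1) ∧ ∏ i, e i = 1 := by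
  rw [mem_specialOrthogonalGroup_iff, mem_orthogonalGroup_iff, diagonal_transpose,
    diagonal_mul_diagonal, det_diagonal, ← diagonal_one, diagonal_eq_diagonal_iff]
  simp only [sq]

end SpecialOrthogonalGroup

section Energy

variable {n : ℕ}

lemma frobSq_nonneg (X : Matrix (Fin n) (Fin n) ℝ) : 0 ≤ frobSq X := by
  simp only [frobSq, trace, diag_apply, mul_apply, transpose_apply]
  exact Finset.sum_nonneg fun i _ => Finset.sum_nonneg fun j _ => mul_self_nonneg _

lemma frobSq_diagonal (d : Fin n → ℝ) : frobSq (diagonal d) = ∑ i, d i ^ 2 := by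
  simp only [frobSq, diagonal_transpose, diagonal_mul_diagonal, trace_diagonal, sq]

lemma frobSq_symPart (X : Matrix (Fin n) (Fin n) ℝ) :
    frobSq (symPart X) = ((Xᵀ * X).trace + (X * X).trace) / 2 := by
  have h₁ : (Xᵀ * Xᵀ).trace = (X * X).trace := by rw [← transpose_mul, trace_transpose]
  have h₂ : (X * Xᵀ).trace = (Xᵀ * X).trace := trace_mul_comm _ _
  simp only [frobSq, symPart, transpose_smul, transpose_add, transpose_transpose, smul_mul_smul,
    Matrix.add_mul, Matrix.mul_add, trace_smul, trace_add, h₁, h₂, smul_eq_mul]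
  ring

lemma frobSq_skewPart (X : Matrix (Fin n) (Fin n) ℝ) :
    frobSq (skewPart X) = ((Xᵀ * X).trace - (X * X).trace) / 2 := by
  have h₁ : (Xᵀ * Xᵀ).trace = (X * X).trace := by rw [← transpose_mul, trace_transpose]
  have h₂ : (X * Xᵀ).trace = (Xᵀ * X).trace := trace_mul_comm _ _
  simp only [frobSq, skewPart, transpose_smul, transpose_sub, transpose_transpose, smul_mul_smul,
    Matrix.sub_mul, Matrix.mul_sub, trace_smul, trace_sub, h₁, h₂, smul_eq_mul]
  ring

lemma freeEnergy_mul (μ μc : ℝ) (F : Matrix (Fin n) (Fin n) ℝ)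
    (V R : specialOrthogonalGroup (Fin n) ℝ) :
    freeEnergy μ μc F (V * R) =
      freeEnergy μ μc ((V : Matrix (Fin n) (Fin n) ℝ)ᵀ * F) R := by
  simp only [freeEnergy, Submonoid.coe_mul, transpose_mul, Matrix.mul_assoc]

lemma isLocalMax_freeEnergy_of_isLocalMax_one {μ μc : ℝ} {F : Matrix (Fin n) (Fin n) ℝ}
    {V : specialOrthogonalGroup (Fin n) ℝ}
    (h : IsLocalMax (freeEnergy μ μc ((V : Matrix (Fin n) (Fin n) ℝ)ᵀ * F)) 1) :
    IsLocalMax (freeEnergy μ μc F) V := by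
  have hcomp : freeEnergy μ μc F =
      freeEnergy μ μc ((V : Matrix (Fin n) (Fin n) ℝ)ᵀ * F) ∘ (V⁻¹ * ·) := by
    ext R
    rw [Function.comp_apply, ← freeEnergy_mul, mul_inv_cancel_left]
  rw [hcomp]
  refine IsLocalMax.comp_continuous ?_ (continuous_const_mul V⁻¹).continuousAt
  rwa [inv_mul_cancel]

lemma freeEnergy_one_zero_diagonal {d e : Fin n → ℝ} {R : specialOrthogonalGroup (Fin n) ℝ}
    (hR : (R : Matrix (Fin n) (Fin n) ℝ) = diagonal e) :
    freeEnergy 1 0 (diagonal d) R = d ⬝ᵥ d - 2 * (e ⬝ᵥ d) + n := by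
  have he : ∀ i, e i ^ 2 = 1 := (diagonal_mem_specialOrthogonalGroup_iff.1 (hR ▸ R.2)).1
  have hdiag : (R : Matrix (Fin n) (Fin n) ℝ)ᵀ * diagonal d - 1 =
      diagonal fun i => e i * d i - 1 := by
    rw [hR, diagonal_transpose, diagonal_mul_diagonal, ← diagonal_one, diagonal_sub]
  have hsym (v : Fin n → ℝ) : symPart (diagonal v) = diagonal v := by
    rw [symPart, diagonal_transpose, ← two_smul ℝ, smul_smul]
    norm_num
  have hsq (i : Fin n) : (e i * d i - 1) ^ 2 = d i * d i - 2 * (e i * d i) + 1 := by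
    linear_combination d i ^ 2 * he i
  simp only [freeEnergy, hdiag, hsym, frobSq_diagonal, hsq, one_mul, zero_mul, add_zero,
    Finset.sum_add_distrib, Finset.sum_sub_distrib, ← Finset.mul_sum, dotProduct,
    Finset.sum_const, Finset.card_univ, Fintype.card_fin, nsmul_eq_mul, mul_one]

end Energy

section ConvexExtension

lemma trace_mul_self_fin_three {K : Type*} [CommRing K] (B : Matrix (Fin 3) (Fin 3) K) :
    (B * B).trace = B.trace ^ 2 - 2 * B.adjugate.trace := by
  simp only [trace_fin_three, mul_apply, Fin.sum_univ_three, adjugate_fin_three, of_apply,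
    cons_val]
  ring

/-- The convex quadratic function of an arbitrary matrix `A` that agrees with `W_{1,0}(· ; F)` on
`SO(3)`. -/
noncomputable def convexExtension (F A : Matrix (Fin 3) (Fin 3) ℝ) : ℝ :=
  frobSq F / 2 + 3 + (Aᵀ * F).trace ^ 2 / 2 - 2 * (Aᵀ * F).trace - (F.adjugate * A).trace

lemma freeEnergy_one_zero_eq_convexExtension (F : Matrix (Fin 3) (Fin 3) ℝ)
    (R : specialOrthogonalGroup (Fin 3) ℝ) : freeEnergy 1 0 F R = convexExtension F R := by
  obtain ⟨A, hA⟩ := R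
  set B := Aᵀ * F with hB
  have hnorm : (Bᵀ * B).trace = frobSq F := by
    rw [hB, transpose_mul, transpose_transpose, Matrix.mul_assoc, ← Matrix.mul_assoc A,
      mul_transpose_of_mem_specialOrthogonalGroup hA, one_mul, frobSq]
  have hadj : B.adjugate = F.adjugate * A := by
    rw [hB, adjugate_mul_distrib, ← adjugate_transpose,
      adjugate_of_mem_specialOrthogonalGroup hA, transpose_transpose]
  have hsq : (B * B).trace = B.trace ^ 2 - 2 * (F.adjugate * A).trace := by
    rw [trace_mul_self_fin_three, hadj]
  simp only [freeEnergy, convexExtension, frobSq_symPart, ← hB, transpose_sub, transpose_one,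
    Matrix.sub_mul, Matrix.mul_sub, one_mul, mul_one, zero_mul, add_zero, trace_sub,
    trace_transpose, trace_one, Fintype.card_fin, hnorm, hsq, Nat.cast_ofNat]
  ring

lemma convexOn_convexExtension (F : Matrix (Fin 3) (Fin 3) ℝ) :
    ConvexOn ℝ univ (convexExtension F) := by
  refine ⟨convex_univ, fun A _ B _ a b ha hb hab => ?_⟩
  obtain rfl : b = 1 - a := by linarith
  have hsq : 0 ≤ a * (1 - a) * ((Aᵀ * F).trace - (Bᵀ * F).trace) ^ 2 :=
    mul_nonneg (mul_nonneg ha hb) (sq_nonneg _)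
  simp only [convexExtension, transpose_add, transpose_smul, Matrix.add_mul, Matrix.mul_add,
    smul_mul_assoc, mul_smul_comm, trace_add, trace_smul, smul_eq_mul]
  linear_combination hsq / 2

lemma convexExtension_diagonal_diag (d : Fin 3 → ℝ) (A : Matrix (Fin 3) (Fin 3) ℝ) :
    convexExtension (diagonal d) (diagonal A.diag) = convexExtension (diagonal d) A := by
  simp only [convexExtension, adjugate_diagonal, trace, diag_apply, diagonal_transpose,
    diagonal_mul_diagonal, diagonal_apply_eq, diagonal_mul, mul_diagonal, transpose_apply]

end ConvexExtension

section LiftedSegments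

lemma le_of_isLocalMin_comp_of_lift_segment {X E : Type*} [TopologicalSpace X] [AddCommGroup E]
    [Module ℝ E] {g : E → ℝ} (hg : ConvexOn ℝ univ g) {p : X → E} {x : X} {v : E}
    (γ : C(unitInterval, X)) (hγ₀ : γ 0 = x) (hγ : ∀ t, p (γ t) = AffineMap.lineMap (p x) v (t : ℝ))
    (hx : IsLocalMin (g ∘ p) x) : g (p x) ≤ g v := by
  let ℓ : ℝ →ᵃ[ℝ] E := AffineMap.lineMap (p x) v
  have hlocal : IsLocalMinOn (g ∘ ℓ) (Icc 0 1) 0 := by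
    have hproj : Tendsto (γ ∘ projIcc (0 : ℝ) 1 zero_le_one) (𝓝 0) (𝓝 x) := by
      have h := (γ.continuous.comp (continuous_projIcc (h := zero_le_one (α := ℝ)))).tendsto 0
      have hproj₀ : projIcc (0 : ℝ) 1 zero_le_one 0 = 0 := projIcc_left _
      rwa [Function.comp_apply, hproj₀, hγ₀] at h
    filter_upwards [nhdsWithin_le_nhds (hproj.eventually hx), self_mem_nhdsWithin] with t hle ht
    simpa [ℓ, hγ, projIcc_of_mem zero_le_one ht] using hle
  have hmin := IsMinOn.of_isLocalMinOn_of_convexOn_Icc one_pos hlocal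
    ((hg.comp_affineMap ℓ).subset (subset_univ _) (convex_Icc 0 1))
  simpa [ℓ] using hmin (right_mem_Icc.2 zero_le_one)

lemma exists_continuousMap_sq_eq_lineMap (a : ℝ) {b : ℝ} (hb : 0 ≤ b) :
    ∃ γ : C(unitInterval, ℝ), γ 0 = a ∧
      ∀ t, γ t ^ 2 = AffineMap.lineMap (a ^ 2) b (t : ℝ) := by
  have hnonneg (t : unitInterval) : 0 ≤ AffineMap.lineMap (a ^ 2) b (t : ℝ) :=
    (convex_Ici (0 : ℝ)).lineMap_mem (sq_nonneg a) hb t.2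
  let root : C(unitInterval, ℝ) :=
    ⟨fun t => √(AffineMap.lineMap (a ^ 2) b (t : ℝ)), by fun_prop⟩
  have hroot₀ : root 0 = |a| := by simp [root, Real.sqrt_sq_eq_abs]
  have hroot (t : unitInterval) : root t ^ 2 = AffineMap.lineMap (a ^ 2) b (t : ℝ) :=
    Real.sq_sqrt (hnonneg t)
  rcases le_total 0 a with ha | ha
  · exact ⟨root, by rw [hroot₀, abs_of_nonneg ha], hroot⟩
  · refine ⟨-root, by simp [hroot₀, abs_of_nonpos ha], fun t => ?_⟩
    rw [ContinuousMap.neg_apply, neg_sq, hroot]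

lemma exists_continuousMap_pi_sq_eq_lineMap {ι : Type*} (q : ι → ℝ) {w : ι → ℝ} (hw : 0 ≤ w) :
    ∃ γ : C(unitInterval, ι → ℝ), γ 0 = q ∧
      ∀ t, γ t ^ 2 = AffineMap.lineMap (q ^ 2) w (t : ℝ) := by
  choose γ hγ₀ hγ using fun i => exists_continuousMap_sq_eq_lineMap (q i) (hw i)
  refine ⟨ContinuousMap.pi γ, funext hγ₀, fun t => funext fun i => ?_⟩
  simpa [AffineMap.lineMap_apply] using hγ i t

end LiftedSegments

section Quaternion

/-- The Euler–Rodrigues matrix of the quaternion `q 0 + q 1 i + q 2 j + q 3 k`: for a unit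
quaternion it is the rotation `v ↦ q v q⁻¹` of the imaginary quaternions. -/
def eulerRodrigues {K : Type*} [CommRing K] (q : Fin 4 → K) : Matrix (Fin 3) (Fin 3) K :=
  !![q 0 ^ 2 + q 1 ^ 2 - q 2 ^ 2 - q 3 ^ 2, 2 * (q 1 * q 2 - q 0 * q 3),
      2 * (q 1 * q 3 + q 0 * q 2);
    2 * (q 1 * q 2 + q 0 * q 3), q 0 ^ 2 - q 1 ^ 2 + q 2 ^ 2 - q 3 ^ 2,
      2 * (q 2 * q 3 - q 0 * q 1);
    2 * (q 1 * q 3 - q 0 * q 2), 2 * (q 2 * q 3 + q 0 * q 1),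
      q 0 ^ 2 - q 1 ^ 2 - q 2 ^ 2 + q 3 ^ 2]

section CommRing

variable {K : Type*} [CommRing K] (q : Fin 4 → K)

lemma eulerRodrigues_mul_transpose :
    eulerRodrigues q * (eulerRodrigues q)ᵀ = (∑ i, q i ^ 2) ^ 2 • 1 := by
  ext i j
  fin_cases i <;> fin_cases j <;>
    simp [eulerRodrigues, mul_apply, Fin.sum_univ_three, Fin.sum_univ_four] <;> ring

lemma det_eulerRodrigues : (eulerRodrigues q).det = (∑ i, q i ^ 2) ^ 3 := by
  simp only [eulerRodrigues, det_fin_three, of_apply, cons_val, Fin.sum_univ_four]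
  ring

variable {q} in
lemma eulerRodrigues_mem_specialOrthogonalGroup (hq : ∑ i, q i ^ 2 = 1) :
    eulerRodrigues q ∈ specialOrthogonalGroup (Fin 3) K :=
  mem_specialOrthogonalGroup_of_mul_transpose
    (by rw [eulerRodrigues_mul_transpose, hq, one_pow, one_smul])
    (by rw [det_eulerRodrigues, hq, one_pow])

lemma diag_eulerRodrigues :
    (eulerRodrigues q).diag =
      ![q 0 ^ 2 + q 1 ^ 2 - q 2 ^ 2 - q 3 ^ 2, q 0 ^ 2 - q 1 ^ 2 + q 2 ^ 2 - q 3 ^ 2,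
        q 0 ^ 2 - q 1 ^ 2 - q 2 ^ 2 + q 3 ^ 2] := by
  ext i
  fin_cases i <;> rfl

lemma continuous_eulerRodrigues [TopologicalSpace K] [IsTopologicalRing K] :
    Continuous (eulerRodrigues : (Fin 4 → K) → Matrix (Fin 3) (Fin 3) K) := by
  unfold eulerRodrigues
  fun_prop

end CommRing

lemma exists_vecMulVec_self_eq {ι : Type*} [Fintype ι] {G : Matrix ι ι ℝ}
    (hG : ∀ i j k, G i i * G j k = G i j * G i k) (htrace : 0 < G.trace) :
    ∃ q : ι → ℝ, vecMulVec q q = G := by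
  obtain ⟨i, -, hi⟩ : ∃ i ∈ Finset.univ, 0 < G i i := by
    by_contra! hdiag
    exact htrace.not_ge (Finset.sum_nonpos hdiag)
  refine ⟨fun j => G i j / √(G i i), Matrix.ext fun j k => ?_⟩
  rw [vecMulVec_apply, div_mul_div_comm, Real.mul_self_sqrt hi.le, ← hG,
    mul_div_cancel_left₀ _ hi.ne']

/-- The matrix that equals `4 q qᵀ` when `A` is the rotation of a unit quaternion `q`. -/
def quaternionGram {K : Type*} [CommRing K] (A : Matrix (Fin 3) (Fin 3) K) :
    Matrix (Fin 4) (Fin 4) K :=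
  !![1 + A 0 0 + A 1 1 + A 2 2, A 2 1 - A 1 2, A 0 2 - A 2 0, A 1 0 - A 0 1;
    A 2 1 - A 1 2, 1 + A 0 0 - A 1 1 - A 2 2, A 1 0 + A 0 1, A 0 2 + A 2 0;
    A 0 2 - A 2 0, A 1 0 + A 0 1, 1 - A 0 0 + A 1 1 - A 2 2, A 2 1 + A 1 2;
    A 1 0 - A 0 1, A 0 2 + A 2 0, A 2 1 + A 1 2, 1 - A 0 0 - A 1 1 + A 2 2]

lemma trace_quaternionGram {K : Type*} [CommRing K] (A : Matrix (Fin 3) (Fin 3) K) :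
    (quaternionGram A).trace = 4 := by
  simp only [quaternionGram, trace, diag_apply, of_apply, cons_val, Fin.sum_univ_four]
  ring

lemma quaternionGram_mul_eq {A : Matrix (Fin 3) (Fin 3) ℝ}
    (hA : A ∈ specialOrthogonalGroup (Fin 3) ℝ) (i j k : Fin 4) :
    quaternionGram A i i * quaternionGram A j k =
      quaternionGram A i j * quaternionGram A i k := by
  have hrow := mul_transpose_of_mem_specialOrthogonalGroup hA
  have hcol := transpose_mul_of_mem_specialOrthogonalGroup hA
  have hcof := adjugate_of_mem_specialOrthogonalGroup hA
  simp only [← Matrix.ext_iff, mul_apply, transpose_apply, Fin.sum_univ_three, Fin.forall_fin_succ,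
    Fin.succ_zero_eq_one, Fin.succ_one_eq_two, IsEmpty.forall_iff, and_true, one_apply_eq, ne_eq,
    zero_ne_one, not_false_eq_true, one_apply_ne, Fin.reduceEq, Fin.succ_ne_zero,
    adjugate_fin_three, of_apply, cons_val', cons_val_fin_one, cons_val_zero, cons_val_succ]
    at hrow hcol hcof
  -- Each identity is a linear combination of the entries of `hrow`, `hcol` and `hcof`.
  fin_cases i <;> fin_cases j <;> fin_cases k <;> simp [quaternionGram] <;> linarith

lemma exists_eulerRodrigues_eq {A : Matrix (Fin 3) (Fin 3) ℝ}
    (hA : A ∈ specialOrthogonalGroup (Fin 3) ℝ) :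
    ∃ q : Fin 4 → ℝ, ∑ i, q i ^ 2 = 1 ∧ eulerRodrigues q = A := by
  obtain ⟨p, hp⟩ := exists_vecMulVec_self_eq (quaternionGram_mul_eq hA)
    (by rw [trace_quaternionGram]; norm_num)
  have hmul (i j : Fin 4) : p i / 2 * (p j / 2) = quaternionGram A i j / 4 := by
    rw [← hp, vecMulVec_apply]
    ring
  refine ⟨fun i => p i / 2, ?_, ?_⟩
  · have htrace : ∑ i, quaternionGram A i i = 4 := trace_quaternionGram A
    simp only [sq, hmul, ← Finset.sum_div, htrace]
    norm_num
  · ext i j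
    fin_cases i <;> fin_cases j <;>
      simp [eulerRodrigues, sq, hmul, quaternionGram] <;> ring

lemma exists_path_diag_eq_lineMap (R S : specialOrthogonalGroup (Fin 3) ℝ) :
    ∃ γ : C(unitInterval, specialOrthogonalGroup (Fin 3) ℝ), γ 0 = R ∧
      ∀ t, (γ t).1.diag = AffineMap.lineMap R.1.diag S.1.diag (t : ℝ) := by
  obtain ⟨q, hq, hqR⟩ := exists_eulerRodrigues_eq R.2
  obtain ⟨r, hr, hrS⟩ := exists_eulerRodrigues_eq S.2
  obtain ⟨γ, hγ₀, hγ⟩ :=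
    exists_continuousMap_pi_sq_eq_lineMap q (w := r ^ 2) fun i => sq_nonneg (r i)
  have hsq (t : unitInterval) (i : Fin 4) : γ t i ^ 2 = (1 - t) * q i ^ 2 + t * r i ^ 2 := by
    simpa [AffineMap.lineMap_apply_module] using congrFun (hγ t) i
  have hunit (t : unitInterval) : ∑ i, γ t i ^ 2 = 1 := by
    simp only [hsq, Finset.sum_add_distrib, ← Finset.mul_sum, hq, hr]
    ring
  refine ⟨⟨fun t => ⟨eulerRodrigues (γ t), eulerRodrigues_mem_specialOrthogonalGroup (hunit t)⟩,
    (continuous_eulerRodrigues.comp γ.continuous).subtype_mk _⟩, ?_, fun t => ?_⟩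
  · ext1
    simpa [hγ₀] using hqR
  · change (eulerRodrigues (γ t)).diag = _
    rw [← hqR, ← hrS]
    simp only [diag_eulerRodrigues]
    ext i
    fin_cases i <;> simp [hsq, AffineMap.lineMap_apply_module] <;> ring

end Quaternion

theorem freeEnergy_le_of_isLocalMin {d : Fin 3 → ℝ} {R : specialOrthogonalGroup (Fin 3) ℝ}
    (hR : IsLocalMin (freeEnergy 1 0 (diagonal d)) R) (S : specialOrthogonalGroup (Fin 3) ℝ) :
    freeEnergy 1 0 (diagonal d) R ≤ freeEnergy 1 0 (diagonal d) S := by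
  have hg : ConvexOn ℝ univ (convexExtension (diagonal d) ∘ diagonalLinearMap (Fin 3) ℝ ℝ) :=
    (convexOn_convexExtension (diagonal d)).comp_linearMap (diagonalLinearMap (Fin 3) ℝ ℝ)
  have hfactor (T : specialOrthogonalGroup (Fin 3) ℝ) : freeEnergy 1 0 (diagonal d) T =
      (convexExtension (diagonal d) ∘ diagonalLinearMap (Fin 3) ℝ ℝ) T.1.diag :=
    (freeEnergy_one_zero_eq_convexExtension _ T).trans (convexExtension_diagonal_diag d T.1).symm
  obtain ⟨γ, hγ₀, hγ⟩ := exists_path_diag_eq_lineMap R S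
  rw [funext hfactor] at hR
  rw [hfactor, hfactor]
  exact le_of_isLocalMin_comp_of_lift_segment hg
    (p := fun T : specialOrthogonalGroup (Fin 3) ℝ => T.1.diag) γ hγ₀ hγ hR

section LocalMaxima

lemma neg_one_le_trace {A : Matrix (Fin 3) (Fin 3) ℝ}
    (hA : A ∈ specialOrthogonalGroup (Fin 3) ℝ) : -1 ≤ A.trace := by
  have hskew : frobSq (skewPart A) = (3 - A.trace) * (1 + A.trace) / 2 := by
    rw [frobSq_skewPart, transpose_mul_of_mem_specialOrthogonalGroup hA, trace_mul_self_fin_three,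
      adjugate_of_mem_specialOrthogonalGroup hA, trace_transpose, trace_one, Fintype.card_fin]
    push_cast
    ring
  have := frobSq_nonneg (skewPart A)
  by_contra! h
  nlinarith

lemma trace_le_one_add_two_mul_diag {A : Matrix (Fin 3) (Fin 3) ℝ}
    (hA : A ∈ specialOrthogonalGroup (Fin 3) ℝ) (i : Fin 3) : A.trace ≤ 1 + 2 * A i i := by
  let e : Fin 3 → ℝ := fun j => if j = i then 1 else -1
  have he : diagonal e ∈ specialOrthogonalGroup (Fin 3) ℝ := by
    refine diagonal_mem_specialOrthogonalGroup_iff.2 ⟨fun j => ?_, ?_⟩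
    · by_cases h : j = i <;> simp [e, h]
    · fin_cases i <;> simp [e, Fin.prod_univ_three]
  have htrace : (diagonal e * A).trace = 2 * A i i - A.trace := by
    fin_cases i <;> simp [e, trace_fin_three] <;> ring
  linarith [neg_one_le_trace (mul_mem he hA)]

/-- The numbers `(1 + 2 * A i i - A.trace) / 4` are the barycentric coordinates of the diagonal of
`A` at the three vertices of the tetrahedron other than `1`. The indices `i + 1` and `i + 2`, taken
modulo 3, are those where the `i`-th of these vertices has the entry `-1`. -/
lemma convexExtension_diagonal_eq_add_sum (m : Fin 3 → ℝ) (A : Matrix (Fin 3) (Fin 3) ℝ) :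
    convexExtension (diagonal m) A = convexExtension (diagonal m) 1 +
      (∑ i, (1 + 2 * A i i - A.trace) * ((m (i + 1) + m (i + 2)) *
        (2 - (m (i + 1) + m (i + 2)) + (∑ j, m j * (1 - A j j)) / 2))) / 2 := by
  have herase : Finset.univ.erase (0 : Fin 3) = {1, 2} ∧ Finset.univ.erase (1 : Fin 3) = {0, 2} ∧
      Finset.univ.erase (2 : Fin 3) = {0, 1} := by decide
  simp only [convexExtension, trace_fin_three, mul_diagonal, transpose_apply, adjugate_diagonal,
    diagonal_mul, herase, Finset.mem_singleton, Fin.reduceEq, not_false_eq_true, Finset.prod_insert,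
    Finset.prod_singleton, zero_ne_one, transpose_one, one_mul, trace_diagonal, Fin.sum_univ_three,
    mul_one, zero_add, Fin.reduceAdd]
  ring

theorem isLocalMax_freeEnergy_one {m : Fin 3 → ℝ}
    (hm : ∀ i, m (i + 1) + m (i + 2) < 0 ∨ 2 < m (i + 1) + m (i + 2)) :
    IsLocalMax (freeEnergy 1 0 (diagonal m)) 1 := by
  let s (i : Fin 3) : ℝ := m (i + 1) + m (i + 2)
  let slope (i : Fin 3) (S : specialOrthogonalGroup (Fin 3) ℝ) : ℝ :=
    s i * (2 - s i + (∑ j, m j * (1 - S.1 j j)) / 2)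
  have hentry (j : Fin 3) : Continuous fun S : specialOrthogonalGroup (Fin 3) ℝ => S.1 j j :=
    Continuous.matrix_elem (A := fun S : specialOrthogonalGroup (Fin 3) ℝ => S.1)
      continuous_subtype_val j j
  have hcont (i : Fin 3) : Continuous (slope i) := by
    have hsum : Continuous fun S : specialOrthogonalGroup (Fin 3) ℝ =>
        ∑ j, m j * (1 - S.1 j j) :=
      continuous_finsetSum _ fun j _ => continuous_const.mul (continuous_const.sub (hentry j))
    exact continuous_const.mul (continuous_const.add (hsum.div_const 2))
  have hslope_one (i : Fin 3) : slope i 1 < 0 := by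
    have hone : slope i 1 = s i * (2 - s i) := by simp [slope]
    rw [hone]
    rcases hm i with hi | hi
    · exact mul_neg_of_neg_of_pos hi (by linarith)
    · exact mul_neg_of_pos_of_neg (by linarith) (by linarith)
  have hslope : ∀ᶠ S in 𝓝 1, ∀ i, slope i S < 0 :=
    eventually_all.2 fun i => (hcont i).continuousAt.eventually_lt_const (hslope_one i)
  filter_upwards [hslope] with S hS
  have hsum : ∑ i, (1 + 2 * S.1 i i - S.1.trace) * slope i S ≤ 0 :=
    Finset.sum_nonpos fun i _ => mul_nonpos_of_nonneg_of_nonpos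
      (sub_nonneg.2 (trace_le_one_add_two_mul_diag S.2 i)) (hS i).le
  rw [freeEnergy_one_zero_eq_convexExtension, freeEnergy_one_zero_eq_convexExtension,
    convexExtension_diagonal_eq_add_sum, Submonoid.coe_one]
  linarith

theorem isNonglobalLocalMax_freeEnergy {d e f : Fin 3 → ℝ}
    {R : specialOrthogonalGroup (Fin 3) ℝ} (hR : (R : Matrix (Fin 3) (Fin 3) ℝ) = diagonal e)
    (hlocal : ∀ i, e (i + 1) * d (i + 1) + e (i + 2) * d (i + 2) < 0 ∨
      2 < e (i + 1) * d (i + 1) + e (i + 2) * d (i + 2))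
    (hf : diagonal f ∈ specialOrthogonalGroup (Fin 3) ℝ) (hlt : f ⬝ᵥ d < e ⬝ᵥ d) :
    IsNonglobalLocalMax (freeEnergy 1 0 (diagonal d)) R := by
  refine ⟨isLocalMax_freeEnergy_of_isLocalMax_one ?_, fun hmax => ?_⟩
  · rw [hR, diagonal_transpose, diagonal_mul_diagonal]
    exact isLocalMax_freeEnergy_one hlocal
  · have hle := hmax ⟨diagonal f, hf⟩
    rw [freeEnergy_one_zero_diagonal hR, freeEnergy_one_zero_diagonal rfl] at hle
    linarith

theorem isNonglobalLocalMax_reducedEnergy {l₁ l₂ l₃ : ℝ} (h₁₂ : l₁ > l₂) (h₂₃ : l₂ > l₃)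
    (hpos : l₂ + l₃ > 0) {R : specialOrthogonalGroup (Fin 3) ℝ}
    (hR : (R : Matrix (Fin 3) (Fin 3) ℝ) = 1 ∧ l₂ + l₃ > 2 ∨
      (R : Matrix (Fin 3) (Fin 3) ℝ) = diagonal ![1, -1, -1] ∧ l₁ - l₂ > 2 ∨
      (R : Matrix (Fin 3) (Fin 3) ℝ) = diagonal ![-1, 1, -1] ∧ l₂ - l₃ > 2) :
    IsNonglobalLocalMax (reducedEnergy l₁ l₂ l₃) R := by
  have hf : diagonal ![(-1 : ℝ), -1, 1] ∈ specialOrthogonalGroup (Fin 3) ℝ := by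
    simp [diagonal_mem_specialOrthogonalGroup_iff, Fin.forall_fin_succ, Fin.prod_univ_three]
  rcases hR with ⟨hR, h⟩ | ⟨hR, h⟩ | ⟨hR, h⟩
  · have hR' : (R : Matrix (Fin 3) (Fin 3) ℝ) = diagonal ![1, 1, 1] := by
      rw [hR, ← diagonal_one]
      exact congrArg diagonal (by ext i; fin_cases i <;> rfl)
    refine isNonglobalLocalMax_freeEnergy hR' ?_ hf ?_
    · simp [Fin.forall_fin_succ]
      grind
    · simp
      linarith
  · refine isNonglobalLocalMax_freeEnergy hR ?_ hf ?_
    · simp [Fin.forall_fin_succ]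
      grind
    · simp
      linarith
  · refine isNonglobalLocalMax_freeEnergy hR ?_ hf ?_
    · simp [Fin.forall_fin_succ]
      grind
    · simp
      linarith

end LocalMaxima

end Cosserat

theorem mainTheorem9_general :
    (∀ l₁ l₂ l₃ : ℝ, ∀ R : Matrix.specialOrthogonalGroup (Fin 3) ℝ,
      IsLocalMin (Cosserat.reducedEnergy l₁ l₂ l₃) R →
        ∀ S : Matrix.specialOrthogonalGroup (Fin 3) ℝ,
          Cosserat.reducedEnergy l₁ l₂ l₃ R ≤ Cosserat.reducedEnergy l₁ l₂ l₃ S) ∧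
    (∃ l₁ l₂ l₃ : ℝ, l₁ ≥ l₂ ∧ l₂ ≥ l₃ ∧ l₃ > 0 ∧
      ∃ R : Matrix.specialOrthogonalGroup (Fin 3) ℝ,
        Cosserat.IsNonglobalLocalMax (Cosserat.reducedEnergy l₁ l₂ l₃) R) ∧
    (∀ l₁ l₂ l₃ : ℝ, l₁ > l₂ → l₂ > l₃ → l₂ + l₃ > 0 →
      ∀ R : Matrix.specialOrthogonalGroup (Fin 3) ℝ,
        ((R : Matrix (Fin 3) (Fin 3) ℝ) = 1 ∧ l₂ + l₃ > 2 ∨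
          (R : Matrix (Fin 3) (Fin 3) ℝ) = Matrix.diagonal ![1, -1, -1] ∧ l₁ - l₂ > 2 ∨
          (R : Matrix (Fin 3) (Fin 3) ℝ) = Matrix.diagonal ![-1, 1, -1] ∧ l₂ - l₃ > 2) →
        Cosserat.IsNonglobalLocalMax (Cosserat.reducedEnergy l₁ l₂ l₃) R) := by
  refine ⟨fun _ _ _ _ hR => Cosserat.freeEnergy_le_of_isLocalMin hR,
    ⟨4, 3, 2, by norm_num, by norm_num, by norm_num, 1, ?_⟩,
    fun _ _ _ h₁₂ h₂₃ hpos _ => Cosserat.isNonglobalLocalMax_reducedEnergy h₁₂ h₂₃ hpos⟩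
  exact Cosserat.isNonglobalLocalMax_reducedEnergy (by norm_num) (by norm_num) (by norm_num)
    (Or.inl ⟨rfl, by norm_num⟩)

theorem mainTheorem9 :
    (∀ l₁ l₂ l₃ : ℝ, l₁ ≥ l₂ → l₂ ≥ l₃ → l₃ > 0 →
      ∀ R : Matrix.specialOrthogonalGroup (Fin 3) ℝ,
        IsLocalMin (Cosserat.reducedEnergy l₁ l₂ l₃) R →
          ∀ S : Matrix.specialOrthogonalGroup (Fin 3) ℝ,
            Cosserat.reducedEnergy l₁ l₂ l₃ R ≤ Cosserat.reducedEnergy l₁ l₂ l₃ S) ∧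
    (∃ l₁ l₂ l₃ : ℝ, l₁ ≥ l₂ ∧ l₂ ≥ l₃ ∧ l₃ > 0 ∧
      ∃ R : Matrix.specialOrthogonalGroup (Fin 3) ℝ,
        Cosserat.IsNonglobalLocalMax (Cosserat.reducedEnergy l₁ l₂ l₃) R) ∧
    (∀ l₁ l₂ l₃ : ℝ, l₁ > l₂ → l₂ > l₃ → l₃ > 0 →
      ∀ R : Matrix.specialOrthogonalGroup (Fin 3) ℝ,
        ((R : Matrix (Fin 3) (Fin 3) ℝ) = 1 ∧ l₂ + l₃ > 2 ∨
          (R : Matrix (Fin 3) (Fin 3) ℝ) = Matrix.diagonal ![1, -1, -1] ∧ l₁ - l₂ > 2 ∨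
          (R : Matrix (Fin 3) (Fin 3) ℝ) = Matrix.diagonal ![-1, 1, -1] ∧ l₂ - l₃ > 2) →
        Cosserat.IsNonglobalLocalMax (Cosserat.reducedEnergy l₁ l₂ l₃) R) := by
  obtain ⟨hmin, hex, hmax⟩ := mainTheorem9_general
  exact ⟨fun l₁ l₂ l₃ _ _ _ => hmin l₁ l₂ l₃, hex,
    fun l₁ l₂ l₃ h₁₂ h₂₃ h₃ => hmax l₁ l₂ l₃ h₁₂ h₂₃ (by linarith)⟩
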